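/- Asymptotic consensus of decentralized push-sum Langevin dynamics. Let nodes $1,\dots,m$ communicate over a sequence of directed graphs $\mathcal G(t)=(\{1,\dots,m\},\mathcal E(t))$, $t=0,1,2,\dots$, that is $B$-strongly connected: for some integer $B\ge 1$ and every $k\ge 0$, the graph with edge set $\bigcup_{s=kB}^{(k+1)B-1}\mathcal E(s)$ is strongly connected. Put $\mathcal N_i^{in}(t)=\{j:(j,i)\in\mathcal E(t)\}\cup\{i\}$ and $d_j(t)=|\{l:(j,l)\in\mathcal E(t)\}\cup\{j\}|$. Let each $U_i:\mathbb R^d\to\mathbb R$ be differentiable with $L$-Lipschitz gradient and strongly convex with constant $\mu>0$. Let the step sizes satisfy $0<\alpha(t)\le a/(1+t)$ for a constant $a$ (for instance $\alpha(t)=\alpha(0)/(1+t)$). Starting from $X_{(i)}(0)=0$, $Y_{(i)}(0)=1$, define for $t\ge 0$ \[ W_{(i)}(t+1)=\sum_{j\in\mathcal N_i^{in}(t)}\frac{X_{(j)}(t)}{d_j(t)},\qquad Y_{(i)}(t+1)=\sum_{j\in\mathcal N_i^{in}(t)}\frac{Y_{(j)}(t)}{d_j(t)},\qquad Z_{(i)}(t+1)=\frac{W_{(i)}(t+1)}{Y_{(i)}(t+1)},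 \] \[ X_{(i)}(t+1)=W_{(i)}(t+1)-\alpha(t+1)\nabla U_i(Z_{(i)}(t+1))+\sqrt{2\alpha(t+1)}\,B_{(i)}(t+1), \] where $B_{(i)}(t+1)=\sqrt{\alpha(t+1)}\,\xi_{(i)}(t+1)+R_{(i)}(t+1)$ and, for a filtration $(\mathcal F_t)$ with $\xi_{(i)}(t+1)$ and $R_{(i)}(t+1)$ being $\mathcal F_{t+1}$-measurable: the stochastic gradient errors satisfy $\mathbb E[\xi_{(i)}(t+1)\mid\mathcal F_t]=0$ and $\mathbb E\|\xi_{(i)}(t+1)\|^2\le\sigma^2$ for all $i,t$; and $R_{(i)}(t+1)$ is independent of $\mathcal F_t$ and has the isotropic Gaussian law $N(0,\tau^2 I_d)$, with $\tau$ independent of $i,t$. Let $\bar X(t)=\frac1m\sum_{i=1}^m X_{(i)}(t)$. Then for every $\gamma>0$ there is a constant $C_\gamma>0$ such that for all $t\ge 1$ and all $i$, $\bar X(t)-Z_{(i)}(t+1)$ is integrable and \[ \mathbb E\,\bigl\|\bar X(t)-Z_{(i)}(t+1)\bigr\|\le\frac{C_\gamma}{t^{1/2-\gamma}} . \] -/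

import Mathlib

open MeasureTheory ProbabilityTheory

noncomputable section

namespace PushSumLangevin

/-- In-neighbours of node `i`: all `j` with an edge `j → i`, together with `i` itself. -/
def inNeighbors {m : ℕ} (G : Digraph (Fin m)) (i : Fin m) : Finset (Fin m) :=
  open Classical in Finset.univ.filter fun j => G.Adj j i ∨ j = i

/-- Out-neighbours of node `i`: all `j` with an edge `i → j`, together with `i` itself. -/
def outNeighbors {m : ℕ} (G : Digraph (Fin m)) (i : Fin m) : Finset (Fin m) :=
  open Classical in Finset.univ.filter fun j => G.Adj i j ∨ j = i

/-- Out-degree of node `i` (the node itself is counted, so it is at least one). -/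
def outDegree {m : ℕ} (G : Digraph (Fin m)) (i : Fin m) : ℕ :=
  (outNeighbors G i).card

/-- The sequence `G 0, G 1, …` is `B`-strongly connected: `B ≥ 1`, and for every `k` the graph whose
edge set is the union of the edge sets of `G (k B), …, G ((k + 1) B - 1)` is strongly connected. -/
def IsBStronglyConnected {m : ℕ} (G : ℕ → Digraph (Fin m)) (B : ℕ) : Prop :=
  0 < B ∧ ∀ k : ℕ, ∀ i j : Fin m,
    Relation.ReflTransGen (fun u v => ∃ s ∈ Finset.Ico (k * B) ((k + 1) * B), (G s).Adj u v) i j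

/-- One application of the column-stochastic mixing matrix of `G` to a stack `x` of vectors:
`(A x)_i = ∑_{j ∈ N_i^in} x_j / d_j`. -/
def mix {m : ℕ} {V : Type*} [AddCommGroup V] [Module ℝ V]
    (G : Digraph (Fin m)) (x : Fin m → V) (i : Fin m) : V :=
  ∑ j ∈ inNeighbors G i, (outDegree G j : ℝ)⁻¹ • x j

/-- The push-sum weights: `Y_i(0) = 1`, `Y(t+1) = A(t) Y(t)`. -/
def weight {m : ℕ} (G : ℕ → Digraph (Fin m)) : ℕ → Fin m → ℝ
  | 0 => fun _ => 1
  | t + 1 => mix (G t) (weight G t)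

/-- The push-sum ratio `Z_i(t+1) = W_i(t+1) / Y_i(t+1)`, `W(t+1) = A(t) X(t)`, computed from the
stack `x = X(t)`. -/
def ratioStep {m d : ℕ} (G : ℕ → Digraph (Fin m)) (t : ℕ)
    (x : Fin m → EuclideanSpace ℝ (Fin d)) (i : Fin m) : EuclideanSpace ℝ (Fin d) :=
  (weight G (t + 1) i)⁻¹ • mix (G t) x i

/-- The iterates `X_i(t)`, driven by a noise path `b`: `X_i(0) = 0` and
`X_i(t+1) = W_i(t+1) - α(t+1) ∇U_i(Z_i(t+1)) + √(2 α(t+1)) b_i(t+1)`. -/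
def iterate {m d : ℕ} (G : ℕ → Digraph (Fin m)) (U : Fin m → EuclideanSpace ℝ (Fin d) → ℝ)
    (α : ℕ → ℝ) (b : ℕ → Fin m → EuclideanSpace ℝ (Fin d)) :
    ℕ → Fin m → EuclideanSpace ℝ (Fin d)
  | 0 => fun _ => 0
  | t + 1 => fun i =>
      mix (G t) (iterate G U α b t) i
        - α (t + 1) • gradient (U i) (ratioStep G t (iterate G U α b t) i)
        + √(2 * α (t + 1)) • b (t + 1) i

/-- The push-sum ratios `Z_i(t)` along the iterates, with `Z_i(0) = 0`. -/
def ratio {m d : ℕ} (G : ℕ → Digraph (Fin m)) (U : Fin m → EuclideanSpace ℝ (Fin d) → ℝ)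
    (α : ℕ → ℝ) (b : ℕ → Fin m → EuclideanSpace ℝ (Fin d)) :
    ℕ → Fin m → EuclideanSpace ℝ (Fin d)
  | 0 => fun _ => 0
  | t + 1 => ratioStep G t (iterate G U α b t)

/-- The network average `X̄(t) = (1/m) ∑_i X_i(t)`. -/
def average {m d : ℕ} (G : ℕ → Digraph (Fin m)) (U : Fin m → EuclideanSpace ℝ (Fin d) → ℝ)
    (α : ℕ → ℝ) (b : ℕ → Fin m → EuclideanSpace ℝ (Fin d)) (t : ℕ) : EuclideanSpace ℝ (Fin d) :=
  (m : ℝ)⁻¹ • ∑ i, iterate G U α b t i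

/-- The noise `B_i(t) = √α(t) ξ_i(t) + R_i(t)`, evaluated at the outcome `ω`. -/
def noise {Ω : Type*} {m d : ℕ} (α : ℕ → ℝ) (ξ R : ℕ → Fin m → Ω → EuclideanSpace ℝ (Fin d))
    (ω : Ω) (t : ℕ) (i : Fin m) : EuclideanSpace ℝ (Fin d) :=
  √(α t) • ξ t i ω + R t i ω

end PushSumLangevin

end

/-! The dynamics is the linear push-sum iteration plus a perturbation formed by the gradient step
and the noise. Rescaled by the push-sum weights, products of the column-stochastic mixing matrices
become row-stochastic, and over a window of `(m + 1) * B` steps all their entries are bounded below.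
Row-stochastic averaging then contracts oscillations, so the rescaled products tend to `1 / m`
geometrically (`exists_geometric_mixing`). Hence the consensus error is at most a geometrically
discounted sum `H` of the perturbation norms (`norm_ratioStep_sub_average_le`).

The perturbation depends on the size of the average through the gradients. Once `α L² ≤ 2μ`, a
gradient step is nonexpansive, so `E‖X̄‖` grows per step by at most `O(E H / t) + O(1 / √t)`, that
is, to `O(√t)`. This crude growth suffices: multiplied by the step size `O(1 / t)` it gives `O(1 /
√t)`, the same order as the noise term, and geometric discounting preserves that order. The two
estimates depend on each other and are closed by one simultaneous induction
(`exists_bound_of_coupled_recursion`). The outcome is the rate `1 / √(t + 1)`, with a constant that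
does not depend on `γ`. -/

namespace PushSumLangevin

/-! ### Mixing matrices, their products, and reachability -/

section Network

variable {m : ℕ}

/-- The matrix of the linear map `mix G`. -/
noncomputable def mixMatrix (G : Digraph (Fin m)) : Matrix (Fin m) (Fin m) ℝ := fun i j =>
  if j ∈ inNeighbors G i then (outDegree G j : ℝ)⁻¹ else 0

lemma mix_eq_sum {V : Type*} [AddCommGroup V] [Module ℝ V] (G : Digraph (Fin m)) (x : Fin m → V)
    (i : Fin m) : mix G x i = ∑ j, mixMatrix G i j • x j := by
  simp [mix, mixMatrix, ite_smul, Finset.sum_ite_mem]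

lemma outDegree_pos (G : Digraph (Fin m)) (i : Fin m) : 0 < outDegree G i :=
  Finset.card_pos.2 ⟨i, by simp [outNeighbors]⟩

lemma outDegree_le (G : Digraph (Fin m)) (i : Fin m) : outDegree G i ≤ m := by
  simpa [outDegree] using Finset.card_le_univ (outNeighbors G i)

lemma mixMatrix_nonneg (G : Digraph (Fin m)) (i j : Fin m) : 0 ≤ mixMatrix G i j := by
  unfold mixMatrix; split_ifs <;> positivity

lemma inv_le_mixMatrix {G : Digraph (Fin m)} {i j : Fin m} (h : j ∈ inNeighbors G i) :
    (m : ℝ)⁻¹ ≤ mixMatrix G i j := by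
  rw [mixMatrix, if_pos h]
  have h1 : (0 : ℝ) < outDegree G j := by exact_mod_cast outDegree_pos G j
  have h2 : (outDegree G j : ℝ) ≤ m := by exact_mod_cast outDegree_le G j
  gcongr

lemma mem_inNeighbors_of_mixMatrix_pos {G : Digraph (Fin m)} {i j : Fin m}
    (h : 0 < mixMatrix G i j) : j ∈ inNeighbors G i := by
  by_contra hn
  simp [mixMatrix, hn] at h

lemma sum_mixMatrix (G : Digraph (Fin m)) (j : Fin m) : ∑ i, mixMatrix G i j = 1 := by
  have h : ∀ i, j ∈ inNeighbors G i ↔ i ∈ outNeighbors G j := fun i => by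
    simp [inNeighbors, outNeighbors, eq_comm]
  have h1 : (outDegree G j : ℝ) ≠ 0 := by exact_mod_cast (outDegree_pos G j).ne'
  simp only [mixMatrix, h, Finset.sum_ite_mem, Finset.univ_inter, Finset.sum_const, nsmul_eq_mul]
  exact mul_inv_cancel₀ h1

lemma self_mem_inNeighbors (G : Digraph (Fin m)) (i : Fin m) : i ∈ inNeighbors G i := by
  simp [inNeighbors]

lemma sum_mix {V : Type*} [AddCommGroup V] [Module ℝ V] (G : Digraph (Fin m)) (x : Fin m → V) :
    ∑ i, mix G x i = ∑ i, x i := by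
  simp only [mix_eq_sum]
  rw [Finset.sum_comm]
  simp [← Finset.sum_smul, sum_mixMatrix]

/-- The product `A(s + n - 1) ⋯ A(s)` of `n` consecutive mixing matrices. -/
noncomputable def transition (G : ℕ → Digraph (Fin m)) (s : ℕ) : ℕ → Matrix (Fin m) (Fin m) ℝ
  | 0 => 1
  | n + 1 => mixMatrix (G (s + n)) * transition G s n

lemma transition_add (G : ℕ → Digraph (Fin m)) (s n k : ℕ) :
    transition G s (n + k) = transition G (s + n) k * transition G s n := by
  induction k with
  | zero => simp [transition]
  | succ k ih => rw [← add_assoc, transition, ih, transition, Matrix.mul_assoc, add_assoc]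

lemma transition_one (G : ℕ → Digraph (Fin m)) (s : ℕ) :
    transition G s 1 = mixMatrix (G s) := by
  simp [transition]

lemma transition_nonneg (G : ℕ → Digraph (Fin m)) (s n : ℕ) (i j : Fin m) :
    0 ≤ transition G s n i j := by
  induction n generalizing i with
  | zero => simp only [transition, Matrix.one_apply]; split_ifs <;> simp
  | succ n ih =>
    rw [transition, Matrix.mul_apply]
    exact Finset.sum_nonneg fun k _ => mul_nonneg (mixMatrix_nonneg _ _ _) (ih k)

lemma sum_transition (G : ℕ → Digraph (Fin m)) (s n : ℕ) (j : Fin m) :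
    ∑ i, transition G s n i j = 1 := by
  induction n with
  | zero => simp [transition, Matrix.one_apply]
  | succ n ih =>
    simp only [transition, Matrix.mul_apply]
    rw [Finset.sum_comm]
    simp [← Finset.sum_mul, sum_mixMatrix, ih]

lemma transition_le_one (G : ℕ → Digraph (Fin m)) (s n : ℕ) (i j : Fin m) :
    transition G s n i j ≤ 1 := by
  rw [← sum_transition G s n j]
  exact Finset.single_le_sum (f := fun i => transition G s n i j)
    (fun i _ => transition_nonneg G s n i j) (Finset.mem_univ i)

lemma weight_add (G : ℕ → Digraph (Fin m)) (s n : ℕ) (i : Fin m) :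
    weight G (s + n) i = ∑ j, transition G s n i j * weight G s j := by
  induction n generalizing i with
  | zero => simp [transition, Matrix.one_apply]
  | succ n ih =>
    rw [← add_assoc, weight, mix_eq_sum]
    simp only [ih, transition, Matrix.mul_apply, smul_eq_mul, Finset.mul_sum, Finset.sum_mul,
      mul_assoc]
    exact Finset.sum_comm

lemma sum_weight (G : ℕ → Digraph (Fin m)) (t : ℕ) : ∑ i, weight G t i = m := by
  induction t with
  | zero => simp [weight]
  | succ t ih => rw [weight, sum_mix, ih]

lemma transition_succ_ge (G : ℕ → Digraph (Fin m)) (s n : ℕ) {i j k : Fin m}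
    (h : k ∈ inNeighbors (G (s + n)) i) :
    (m : ℝ)⁻¹ * transition G s n k j ≤ transition G s (n + 1) i j := by
  rw [transition, Matrix.mul_apply]
  refine le_trans ?_ (Finset.single_le_sum
    (f := fun k => mixMatrix (G (s + n)) i k * transition G s n k j)
    (fun k _ => mul_nonneg (mixMatrix_nonneg _ _ _) (transition_nonneg _ _ _ _ _))
    (Finset.mem_univ k))
  exact mul_le_mul_of_nonneg_right (inv_le_mixMatrix h) (transition_nonneg _ _ _ _ _)

lemma transition_succ_pos (G : ℕ → Digraph (Fin m)) (s n : ℕ) {i j k : Fin m}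
    (h : k ∈ inNeighbors (G (s + n)) i) (hk : 0 < transition G s n k j) :
    0 < transition G s (n + 1) i j := by
  have hm : (0 : ℝ) < m := by exact_mod_cast i.pos
  exact lt_of_lt_of_le (by positivity) (transition_succ_ge G s n h)

lemma transition_pos_mono (G : ℕ → Digraph (Fin m)) (s : ℕ) {n k : ℕ} (hnk : n ≤ k) {i j : Fin m}
    (h : 0 < transition G s n i j) : 0 < transition G s k i j := by
  induction k, hnk using Nat.le_induction with
  | base => exact h
  | succ k _ ih => exact transition_succ_pos G s k (self_mem_inNeighbors _ _) ih

/-- A positive entry comes from at least one path of positive matrix entries, and each of those is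
at least `1 / m`. -/
lemma pow_le_transition (G : ℕ → Digraph (Fin m)) (s n : ℕ) {i j : Fin m}
    (h : 0 < transition G s n i j) : ((m : ℝ)⁻¹) ^ n ≤ transition G s n i j := by
  induction n generalizing i with
  | zero =>
    simp only [transition, Matrix.one_apply] at h ⊢
    split_ifs at h ⊢ <;> simp at h ⊢
  | succ n ih =>
    have h' := h
    rw [transition, Matrix.mul_apply] at h'
    obtain ⟨k, -, hk⟩ := Finset.exists_lt_of_sum_lt (s := Finset.univ) (f := fun _ : Fin m => (0 : ℝ))
      (by simpa using h')
    have hA : 0 < mixMatrix (G (s + n)) i k := pos_of_mul_pos_left hk (transition_nonneg _ _ _ _ _)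
    have hT : 0 < transition G s n k j := pos_of_mul_pos_right hk (mixMatrix_nonneg _ _ _)
    refine le_trans ?_ (transition_succ_ge G s n (mem_inNeighbors_of_mixMatrix_pos hA))
    rw [pow_succ']
    exact mul_le_mul_of_nonneg_left (ih hT) (by positivity)

/-- The nodes that information from `j` at time `s` has reached after `n` steps. -/
noncomputable def reached (G : ℕ → Digraph (Fin m)) (s : ℕ) (j : Fin m) (n : ℕ) : Finset (Fin m) :=
  Finset.univ.filter fun i => 0 < transition G s n i j

lemma mem_reached {G : ℕ → Digraph (Fin m)} {s : ℕ} {i j : Fin m} {n : ℕ} :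
    i ∈ reached G s j n ↔ 0 < transition G s n i j := by simp [reached]

lemma self_mem_reached (G : ℕ → Digraph (Fin m)) (s : ℕ) (j : Fin m) (n : ℕ) :
    j ∈ reached G s j n :=
  mem_reached.2 (transition_pos_mono G s (Nat.zero_le n) (by simp [transition]))

lemma reached_mono (G : ℕ → Digraph (Fin m)) (s : ℕ) (j : Fin m) : Monotone (reached G s j) :=
  fun _ _ h _ hi => mem_reached.2 (transition_pos_mono G s h (mem_reached.1 hi))

/-- If a whole block added no node, the reached set would be closed under every edge of the block,
and strong connectivity would make it everything. -/
lemma reached_block {G : ℕ → Digraph (Fin m)} {B : ℕ} (hG : IsBStronglyConnected G B) {s n k : ℕ}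
    (hk : s + n = k * B) {j : Fin m} (h : reached G s j n ≠ Finset.univ) :
    (reached G s j n).card < (reached G s j (n + B)).card := by
  refine Finset.card_lt_card ⟨reached_mono G s j (Nat.le_add_right n B), fun hsub => h ?_⟩
  refine Finset.eq_univ_iff_forall.2 fun i => ?_
  induction hG.2 k j i with
  | refl => exact self_mem_reached G s j n
  | @tail u v _ huv ih =>
    obtain ⟨r, hr, hadj⟩ := huv
    rw [Finset.mem_Ico, add_mul, one_mul] at hr
    obtain ⟨q, rfl⟩ : ∃ q, r = s + (n + q) := ⟨r - (s + n), by omega⟩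
    apply hsub
    apply reached_mono G s j (show n + q + 1 ≤ n + B by omega)
    have hu := reached_mono G s j (Nat.le_add_right n q) ih
    exact mem_reached.2 (transition_succ_pos G s (n + q) (by simp [inNeighbors, hadj])
      (mem_reached.1 hu))

lemma reached_blocks {G : ℕ → Digraph (Fin m)} {B : ℕ} (hG : IsBStronglyConnected G B) {s n k : ℕ}
    (hk : s + n = k * B) (j : Fin m) (q : ℕ) :
    reached G s j (n + q * B) = Finset.univ ∨ q ≤ (reached G s j (n + q * B)).card := by
  induction q with
  | zero => right; simp
  | succ q ih =>
    have hle : n + q * B ≤ n + (q + 1) * B := by rw [add_mul]; omega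
    by_cases h : reached G s j (n + q * B) = Finset.univ
    · left
      exact Finset.eq_univ_of_forall fun i => reached_mono G s j hle (by simp [h])
    · right
      have h1 := reached_block hG (s := s) (n := n + q * B) (k := k + q)
        (by rw [← add_assoc, hk, add_mul]) (j := j) h
      rw [show n + q * B + B = n + (q + 1) * B by ring] at h1
      have := ih.resolve_left h
      omega

/-- At most `B` steps lead to a block boundary; each of the next `m` blocks adds a node until all
are reached. This is the origin of `(m + 1) * B`. -/
lemma transition_window {G : ℕ → Digraph (Fin m)} {B : ℕ} (hG : IsBStronglyConnected G B)
    (s : ℕ) (i j : Fin m) :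
    ((m : ℝ)⁻¹) ^ ((m + 1) * B) ≤ transition G s ((m + 1) * B) i j := by
  apply pow_le_transition
  rw [← mem_reached]
  have hB := hG.1
  obtain ⟨n, hn, k, hk⟩ : ∃ n ≤ B, ∃ k, s + n = k * B := by
    -- The first block boundary strictly after `s`; a full block is skipped when `B ∣ s`.
    refine ⟨B - s % B, by omega, s / B + 1, ?_⟩
    have h1 := Nat.div_add_mod s B
    have h2 := Nat.mod_lt s hB
    rw [add_mul, one_mul, mul_comm]
    omega
  have hle : n + m * B ≤ (m + 1) * B := by rw [add_mul]; omega
  apply reached_mono G s j hle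
  rcases reached_blocks hG hk j m with h | h
  · simp [h]
  · have : reached G s j (n + m * B) = Finset.univ := by
      apply Finset.eq_univ_of_card
      exact le_antisymm (Finset.card_le_univ _) (by simpa using h)
    simp [this]

/-- After a full window every entry of the product is bounded below and acts on weights of total
mass `m`. At earlier times the self-loops alone keep the diagonal entry above the same power. -/
lemma exists_weight_lower_bound {G : ℕ → Digraph (Fin m)} {B : ℕ} (hG : IsBStronglyConnected G B)
    (hm : 0 < m) : ∃ δ : ℝ, 0 < δ ∧ δ ≤ 1 ∧ ∀ t i, δ ≤ weight G t i := by
  have hm' : (1 : ℝ) ≤ m := by exact_mod_cast hm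
  have hinv : (m : ℝ)⁻¹ ≤ 1 := inv_le_one_of_one_le₀ hm'
  refine ⟨((m : ℝ)⁻¹) ^ ((m + 1) * B), by positivity, pow_le_one₀ (by positivity) hinv,
    fun t i => ?_⟩
  rcases le_total ((m + 1) * B) t with h | h
  · obtain ⟨s, rfl⟩ := Nat.exists_eq_add_of_le' h
    have hw : ∀ t i, 0 ≤ weight G t i := fun t i => by
      have := weight_add G 0 t i
      rw [zero_add] at this
      rw [this]
      exact Finset.sum_nonneg fun j _ => by simpa [weight] using transition_nonneg _ _ _ _ _
    rw [weight_add]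
    calc ((m : ℝ)⁻¹) ^ ((m + 1) * B) ≤ ((m : ℝ)⁻¹) ^ ((m + 1) * B) * m :=
          le_mul_of_one_le_right (by positivity) hm'
      _ = ∑ j, ((m : ℝ)⁻¹) ^ ((m + 1) * B) * weight G s j := by
          rw [← Finset.mul_sum, sum_weight]
      _ ≤ _ := Finset.sum_le_sum fun j _ =>
          mul_le_mul_of_nonneg_right (transition_window hG s i j) (hw s j)
  · have h0 := weight_add G 0 t i
    rw [zero_add] at h0
    simp only [weight, mul_one] at h0
    rw [h0]
    have h1 : 0 < transition G 0 t i i := transition_pos_mono G 0 (Nat.zero_le t)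
      (by simp [transition])
    calc _ ≤ ((m : ℝ)⁻¹) ^ t := pow_le_pow_of_le_one (by positivity) hinv h
      _ ≤ transition G 0 t i i := pow_le_transition G 0 t h1
      _ ≤ _ := Finset.single_le_sum (f := fun j => transition G 0 t i j)
          (fun j _ => transition_nonneg _ _ _ _ _) (Finset.mem_univ i)

/-! ### Contraction of oscillations and geometric mixing -/

/-- A row-stochastic matrix with a column bounded below contracts the oscillation. -/
lemma oscillation_contract {ι : Type*} [Fintype ι] {p : ι → ι → ℝ} {f : ι → ℝ} {η D : ℝ}
    (hp : ∀ i j, 0 ≤ p i j) (j₀ : ι) (hp₀ : ∀ i, η ≤ p i j₀)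
    (hsum : ∀ i, ∑ j, p i j = 1)
    (hf : ∀ i k, f i - f k ≤ D) (i k : ι) :
    ∑ j, p i j * f j - ∑ j, p k j * f j ≤ (1 - η) * D := by
  have hne : (Finset.univ : Finset ι).Nonempty := ⟨j₀, Finset.mem_univ _⟩
  obtain ⟨a, -, ha⟩ := Finset.exists_max_image Finset.univ f hne
  obtain ⟨b, -, hb⟩ := Finset.exists_min_image Finset.univ f hne
  -- Both averages are pulled towards the common value `f j₀` by a fraction `η`; the two gains add
  -- up to `η * (f a - f b)`.
  have h1 : η * (f a - f j₀) ≤ f a - ∑ j, p i j * f j := by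
    calc η * (f a - f j₀) ≤ p i j₀ * (f a - f j₀) :=
          mul_le_mul_of_nonneg_right (hp₀ i) (sub_nonneg.2 (ha j₀ (Finset.mem_univ _)))
      _ ≤ ∑ j, p i j * (f a - f j) := Finset.single_le_sum (f := fun j => p i j * (f a - f j))
          (fun j hj => mul_nonneg (hp i j) (sub_nonneg.2 (ha j hj))) (Finset.mem_univ j₀)
      _ = _ := by simp only [mul_sub, Finset.sum_sub_distrib, ← Finset.sum_mul, hsum, one_mul]
  have h2 : η * (f j₀ - f b) ≤ ∑ j, p k j * f j - f b := by
    calc η * (f j₀ - f b) ≤ p k j₀ * (f j₀ - f b) :=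
          mul_le_mul_of_nonneg_right (hp₀ k) (sub_nonneg.2 (hb j₀ (Finset.mem_univ _)))
      _ ≤ ∑ j, p k j * (f j - f b) := Finset.single_le_sum (f := fun j => p k j * (f j - f b))
          (fun j hj => mul_nonneg (hp k j) (sub_nonneg.2 (hb j hj))) (Finset.mem_univ j₀)
      _ = _ := by simp only [mul_sub, Finset.sum_sub_distrib, ← Finset.sum_mul, hsum, one_mul]
  have h3 : η ≤ 1 := (hp₀ i).trans <| by
    rw [← hsum i]
    exact Finset.single_le_sum (f := fun j => p i j) (fun j _ => hp i j) (Finset.mem_univ j₀)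
  have h4 := mul_le_mul_of_nonneg_left (hf a b) (sub_nonneg.2 h3)
  linarith

/-- The ratios of `transition G s n` to the push-sum weights approach `1 / m` geometrically. -/
theorem exists_geometric_mixing {G : ℕ → Digraph (Fin m)} {B : ℕ} (hG : IsBStronglyConnected G B)
    (hm : 0 < m) : ∃ C lam : ℝ, 0 < C ∧ 0 < lam ∧ lam < 1 ∧ ∀ s n i j,
      |(weight G (s + n) i)⁻¹ * transition G s n i j - (m : ℝ)⁻¹| ≤ C * lam ^ n := by
  obtain ⟨δ, hδ, hδ1, hw⟩ := exists_weight_lower_bound hG hm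
  have hm' : (1 : ℝ) ≤ m := by exact_mod_cast hm
  have hwpos : ∀ t i, 0 < weight G t i := fun t i => hδ.trans_le (hw t i)
  have hwle : ∀ t i, weight G t i ≤ m := fun t i => by
    rw [← sum_weight G t]
    exact Finset.single_le_sum (fun j _ => (hwpos t j).le) (Finset.mem_univ i)
  set N := (m + 1) * B with hN
  have hNpos : 0 < N := Nat.mul_pos (Nat.succ_pos m) hG.1
  have hNpos' : (1 : ℝ) ≤ N := by exact_mod_cast hNpos
  -- The factor `1 / 2` makes `η < 1` strict, so that `lam` below is positive.
  set η : ℝ := (m : ℝ)⁻¹ * ((m : ℝ)⁻¹) ^ N * δ / 2 with hη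
  have hηpos : 0 < η := by positivity
  have hη1 : η < 1 := by
    have h1 : (m : ℝ)⁻¹ ≤ 1 := inv_le_one_of_one_le₀ hm'
    have h2 : ((m : ℝ)⁻¹) ^ N ≤ 1 := pow_le_one₀ (by positivity) h1
    have h3 : (m : ℝ)⁻¹ * ((m : ℝ)⁻¹) ^ N * δ ≤ 1 * 1 * 1 := by gcongr
    rw [hη]; linarith
  -- one application of the window contraction, for any number of steps
  have hcontract : ∀ (s n k : ℕ) (j : Fin m) (θ D : ℝ), 0 ≤ θ →
      (∀ i l, θ ≤ (weight G (s + (n + k)) i)⁻¹ * transition G (s + n) k i l * weight G (s + n) l) →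
      (∀ i l, (weight G (s + n) i)⁻¹ * transition G s n i j
        - (weight G (s + n) l)⁻¹ * transition G s n l j ≤ D) →
      ∀ i l, (weight G (s + (n + k)) i)⁻¹ * transition G s (n + k) i j
        - (weight G (s + (n + k)) l)⁻¹ * transition G s (n + k) l j ≤ (1 - θ) * D := by
    intro s n k j θ D hθ hlow hosc i l
    -- Inserting `Y_l Y_l⁻¹` writes the later ratios as averages of the earlier ones; the
    -- coefficients sum to one in each row because the weights evolve by the same matrices
    -- (`weight_add`).
    have key : ∀ i, (weight G (s + (n + k)) i)⁻¹ * transition G s (n + k) i j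
        = ∑ l, ((weight G (s + (n + k)) i)⁻¹ * transition G (s + n) k i l * weight G (s + n) l)
          * ((weight G (s + n) l)⁻¹ * transition G s n l j) := by
      intro i
      rw [transition_add, Matrix.mul_apply, Finset.mul_sum]
      refine Finset.sum_congr rfl fun l _ => ?_
      have := (hwpos (s + n) l).ne'
      field_simp
    rw [key i, key l]
    refine oscillation_contract (fun i l => hθ.trans (hlow i l)) j (fun i => hlow i j) ?_
      hosc i l
    intro i
    simp only [mul_assoc]
    rw [← Finset.mul_sum, ← weight_add, add_assoc]
    exact inv_mul_cancel₀ (hwpos _ i).ne'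
  have hlowN : ∀ s n i l,
      η ≤ (weight G (s + (n + N)) i)⁻¹ * transition G (s + n) N i l * weight G (s + n) l := by
    intro s n i l
    have h1 : (m : ℝ)⁻¹ ≤ (weight G (s + (n + N)) i)⁻¹ := by
      have := hwpos (s + (n + N)) i
      have := hwle (s + (n + N)) i
      gcongr
    have h2 := transition_window hG (s + n) i l
    have h3 := hw (s + n) l
    have h4 : (m : ℝ)⁻¹ * ((m : ℝ)⁻¹) ^ N * δ ≤
        (weight G (s + (n + N)) i)⁻¹ * transition G (s + n) N i l * weight G (s + n) l := by
      have h5 : 0 ≤ transition G (s + n) N i l := transition_nonneg _ _ _ _ _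
      have h6 : 0 ≤ (weight G (s + (n + N)) i)⁻¹ := inv_nonneg.2 (hwpos _ _).le
      gcongr
    have h7 : 0 < (m : ℝ)⁻¹ * ((m : ℝ)⁻¹) ^ N * δ := by positivity
    rw [hη]; linarith
  -- By Bernoulli's inequality `lam ^ N ≥ 1 - η`, so this rate replaces the `N`-th root of `1 - η`.
  set lam : ℝ := 1 - η / N with hlam
  have hdiv : η / N ≤ η := div_le_self hηpos.le hNpos'
  have hdiv0 : 0 < η / N := by positivity
  have hlam0 : 0 < lam := by rw [hlam]; linarith
  have hlam1 : lam < 1 := by rw [hlam]; linarith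
  have hpow : 1 - η ≤ lam ^ N := by
    have h := one_add_mul_le_pow (a := -(η / N)) (by linarith) N
    have : (N : ℝ) * (η / N) = η := by field_simp
    rw [hlam, sub_eq_add_neg 1 (η / N)]
    linarith
  have hosc0 : ∀ s n i l j, (weight G (s + n) i)⁻¹ * transition G s n i j
        - (weight G (s + n) l)⁻¹ * transition G s n l j ≤ δ⁻¹ := by
    intro s n i l j
    have h1 : 0 ≤ (weight G (s + n) l)⁻¹ * transition G s n l j :=
      mul_nonneg (inv_nonneg.2 (hwpos _ _).le) (transition_nonneg _ _ _ _ _)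
    have h2 : (weight G (s + n) i)⁻¹ * transition G s n i j ≤ δ⁻¹ * 1 := by
      have := hw (s + n) i
      have := transition_nonneg G s n i j
      have := transition_le_one G s n i j
      gcongr
    linarith
  have hosc : ∀ s n i l j, (weight G (s + n) i)⁻¹ * transition G s n i j
        - (weight G (s + n) l)⁻¹ * transition G s n l j ≤ δ⁻¹ * (lam ^ N)⁻¹ * lam ^ n := by
    intro s n
    induction n using Nat.strong_induction_on with
    | _ n ih =>
      intro i l j
      -- An incomplete window has no contraction; the factor `(lam ^ N)⁻¹` pays for it.
      rcases lt_or_ge n N with h | h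
      · refine (hosc0 s n i l j).trans ?_
        rw [mul_assoc]
        refine le_mul_of_one_le_right (by positivity) ?_
        rw [inv_mul_eq_div, one_le_div (by positivity)]
        exact pow_le_pow_of_le_one hlam0.le hlam1.le h.le
      · obtain ⟨n, rfl⟩ := Nat.exists_eq_add_of_le' h
        refine (hcontract s n N j η _ hηpos.le (hlowN s n)
          (fun i l => ih n (by omega) i l j) i l).trans ?_
        calc (1 - η) * (δ⁻¹ * (lam ^ N)⁻¹ * lam ^ n)
            ≤ lam ^ N * (δ⁻¹ * (lam ^ N)⁻¹ * lam ^ n) := by gcongr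
          _ = _ := by ring
  refine ⟨δ⁻¹ * (lam ^ N)⁻¹, lam, by positivity, hlam0, hlam1, fun s n i j => ?_⟩
  -- `1 / m` is the average of the ratios with respect to the weights `weight / m`
  have havg : (m : ℝ)⁻¹ = ∑ l, ((m : ℝ)⁻¹ * weight G (s + n) l) *
      ((weight G (s + n) l)⁻¹ * transition G s n l j) := by
    have : ∀ l, ((m : ℝ)⁻¹ * weight G (s + n) l) *
      ((weight G (s + n) l)⁻¹ * transition G s n l j) = (m : ℝ)⁻¹ * transition G s n l j := by
      intro l
      have := (hwpos (s + n) l).ne'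
      field_simp
    simp only [this, ← Finset.mul_sum, sum_transition, mul_one]
  have hone : ∑ l, (m : ℝ)⁻¹ * weight G (s + n) l = 1 := by
    rw [← Finset.mul_sum, sum_weight]
    exact inv_mul_cancel₀ (by positivity)
  set D := δ⁻¹ * (lam ^ N)⁻¹ * lam ^ n
  have hdiff : (weight G (s + n) i)⁻¹ * transition G s n i j - (m : ℝ)⁻¹
      = ∑ l, ((m : ℝ)⁻¹ * weight G (s + n) l) * ((weight G (s + n) i)⁻¹ * transition G s n i j
        - (weight G (s + n) l)⁻¹ * transition G s n l j) := by
    simp only [mul_sub, Finset.sum_sub_distrib]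
    rw [← havg, ← Finset.sum_mul, hone, one_mul]
  rw [hdiff]
  calc _ ≤ ∑ l, |((m : ℝ)⁻¹ * weight G (s + n) l) * ((weight G (s + n) i)⁻¹ *
        transition G s n i j - (weight G (s + n) l)⁻¹ * transition G s n l j)| :=
        Finset.abs_sum_le_sum_abs _ _
    _ ≤ ∑ l, ((m : ℝ)⁻¹ * weight G (s + n) l) * D := by
        refine Finset.sum_le_sum fun l _ => ?_
        have h0 : 0 ≤ (m : ℝ)⁻¹ * weight G (s + n) l :=
          mul_nonneg (by positivity) (hwpos _ _).le
        rw [abs_mul, abs_of_nonneg h0]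
        refine mul_le_mul_of_nonneg_left (abs_le.2 ⟨?_, hosc s n i l j⟩) h0
        linarith [hosc s n l i j]
    _ = D := by rw [← Finset.sum_mul, hone, one_mul]

/-! ### Consensus error of the perturbed linear iteration -/

/-- The discounted accumulation `H(t+1) = lam H(t) + C e(t+1)`, `H(0) = 0`. -/
def discountedSum (C lam : ℝ) (e : ℕ → ℝ) : ℕ → ℝ
  | 0 => 0
  | t + 1 => lam * discountedSum C lam e t + C * e (t + 1)

lemma discountedSum_nonneg {C lam : ℝ} (hC : 0 ≤ C) (hlam : 0 ≤ lam) {e : ℕ → ℝ}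
    (he : ∀ t, 0 ≤ e t) (t : ℕ) : 0 ≤ discountedSum C lam e t := by
  induction t with
  | zero => exact le_rfl
  | succ t ih => exact add_nonneg (mul_nonneg hlam ih) (mul_nonneg hC (he _))

/-- Consensus error of perturbed push-sum. -/
theorem norm_ratioStep_sub_average_le {d : ℕ} {G : ℕ → Digraph (Fin m)} {C lam : ℝ} (hC : 0 ≤ C)
    (hlam : 0 ≤ lam) (hlam1 : lam ≤ 1)
    (hmix : ∀ s n i j,
      |(weight G (s + n) i)⁻¹ * transition G s n i j - (m : ℝ)⁻¹| ≤ C * lam ^ n)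
    {x e : ℕ → Fin m → EuclideanSpace ℝ (Fin d)} (hx0 : x 0 = 0)
    (hx : ∀ t i, x (t + 1) i = mix (G t) (x t) i + e (t + 1) i) (t : ℕ) (i : Fin m) :
    ‖ratioStep G t (x t) i - (m : ℝ)⁻¹ • ∑ j, x t j‖
      ≤ discountedSum C lam (fun t => ∑ j, ‖e t j‖) t := by
  -- Allowing `n` further unperturbed mixing steps lets the induction on `t` close: the step from
  -- `t` to `t + 1` uses the hypothesis at `n + 1`. The ratio itself is the case `n = 1`.
  have key : ∀ t n i, ‖(weight G (t + n) i)⁻¹ • ∑ j, transition G t n i j • x t j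
      - (m : ℝ)⁻¹ • ∑ j, x t j‖ ≤ lam ^ n * discountedSum C lam (fun t => ∑ j, ‖e t j‖) t := by
    intro t
    induction t with
    | zero => intro n i; simp [hx0, discountedSum]
    | succ t ih =>
      intro n i
      have h1 : ∑ j, transition G (t + 1) n i j • mix (G t) (x t) j
          = ∑ j, transition G t (n + 1) i j • x t j := by
        rw [add_comm n 1, transition_add, transition_one]
        simp only [mix_eq_sum, Matrix.mul_apply, Finset.smul_sum, Finset.sum_smul, smul_smul]
        exact Finset.sum_comm
      have h2 : (weight G (t + 1 + n) i)⁻¹ • ∑ j, transition G (t + 1) n i j • x (t + 1) j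
          - (m : ℝ)⁻¹ • ∑ j, x (t + 1) j
          = ((weight G (t + (n + 1)) i)⁻¹ • ∑ j, transition G t (n + 1) i j • x t j
            - (m : ℝ)⁻¹ • ∑ j, x t j)
          + ∑ j, ((weight G (t + 1 + n) i)⁻¹ * transition G (t + 1) n i j - (m : ℝ)⁻¹)
            • e (t + 1) j := by
        simp only [hx, smul_add, Finset.sum_add_distrib, sum_mix, h1, sub_smul, mul_smul,
          Finset.sum_sub_distrib, ← Finset.smul_sum]
        rw [show t + 1 + n = t + (n + 1) by ring]
        abel
      rw [h2]
      refine (norm_add_le _ _).trans ?_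
      have h3 : ‖∑ j, ((weight G (t + 1 + n) i)⁻¹ * transition G (t + 1) n i j - (m : ℝ)⁻¹)
            • e (t + 1) j‖ ≤ C * lam ^ n * ∑ j, ‖e (t + 1) j‖ := by
        rw [Finset.mul_sum]
        refine norm_sum_le_of_le _ fun j _ => ?_
        rw [norm_smul, Real.norm_eq_abs]
        exact mul_le_mul_of_nonneg_right (hmix (t + 1) n i j) (norm_nonneg _)
      have h4 := ih (n + 1) i
      rw [discountedSum]
      calc _ ≤ _ := add_le_add h4 h3
        _ = _ := by ring
  have h := key t 1 i
  rw [transition_one, pow_one] at h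
  rw [ratioStep, mix_eq_sum]
  refine h.trans (mul_le_of_le_one_left ?_ hlam1)
  exact discountedSum_nonneg hC hlam (fun t => Finset.sum_nonneg fun j _ => norm_nonneg _) t

end Network

/-! ### Gradient steps of smooth strongly convex functions -/

section Analysis

variable {E : Type*} [NormedAddCommGroup E] [InnerProductSpace ℝ E] [CompleteSpace E]

/-- The gradient of a strongly convex function is strongly monotone. -/
lemma inner_gradient_sub_ge {f : E → ℝ} {μ : ℝ} (hf : Differentiable ℝ f)
    (hconv : StrongConvexOn Set.univ μ f) (x y : E) :
    μ * ‖y - x‖ ^ 2 ≤ inner ℝ (gradient f y - gradient f x) (y - x) := by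
  -- Along the segment, `f - μ/2 ‖·‖²` is a convex function of one variable; monotonicity of its
  -- derivative between `0` and `1` is the claim.
  set h : ℝ → ℝ := fun s => f (AffineMap.lineMap x y s) - μ / 2 * ‖AffineMap.lineMap x y s‖ ^ 2
    with hh
  have hc : ConvexOn ℝ Set.univ h := by
    have := (strongConvexOn_iff_convex.1 hconv).comp_affineMap (AffineMap.lineMap x y : ℝ →ᵃ[ℝ] E)
    simpa [Function.comp_def] using this
  have hd : ∀ s, HasDerivAt h (inner ℝ (gradient f (AffineMap.lineMap x y s)) (y - x)
      - μ * inner ℝ (AffineMap.lineMap x y s) (y - x)) s := by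
    intro s
    have hl : HasDerivAt (fun s : ℝ => AffineMap.lineMap x y s) (y - x) s :=
      AffineMap.hasDerivAt_lineMap
    have h1 := (hf (AffineMap.lineMap x y s)).hasGradientAt.hasFDerivAt.comp_hasDerivAt s hl
    have h2 := (hl.norm_sq).const_mul (μ / 2)
    refine (h1.sub h2).congr_deriv ?_
    rw [InnerProductSpace.toDual_apply_apply]
    ring
  have hmono := hc.monotoneOn_deriv (fun s _ => (hd s).differentiableAt)
    (Set.mem_univ (0 : ℝ)) (Set.mem_univ (1 : ℝ)) zero_le_one
  rw [(hd 0).deriv, (hd 1).deriv] at hmono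
  simp only [AffineMap.lineMap_apply_zero, AffineMap.lineMap_apply_one] at hmono
  have h3 : ‖y - x‖ ^ 2 = inner ℝ y (y - x) - inner ℝ x (y - x) := by
    rw [← inner_sub_left, real_inner_self_eq_norm_sq]
  rw [inner_sub_left, h3]
  linarith

/-- A small gradient step of a smooth strongly convex function is nonexpansive. -/
lemma norm_gradient_step_sub_le {f : E → ℝ} {μ η : ℝ} {L : NNReal} (hf : Differentiable ℝ f)
    (hlip : LipschitzWith L (gradient f)) (hconv : StrongConvexOn Set.univ μ f) (hη : 0 ≤ η)
    (hη' : η * L ^ 2 ≤ 2 * μ) (x y : E) :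
    ‖(y - η • gradient f y) - (x - η • gradient f x)‖ ≤ ‖y - x‖ := by
  have h1 := inner_gradient_sub_ge hf hconv x y
  have h2 : ‖gradient f y - gradient f x‖ ≤ L * ‖y - x‖ := by
    simpa [dist_eq_norm] using hlip.dist_le_mul y x
  have h3 : (y - η • gradient f y) - (x - η • gradient f x)
      = (y - x) - η • (gradient f y - gradient f x) := by
    rw [smul_sub]; abel
  rw [h3]
  refine le_of_sq_le_sq ?_ (norm_nonneg _)
  rw [norm_sub_sq_real, real_inner_smul_right, norm_smul, Real.norm_of_nonneg hη,
    real_inner_comm]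
  have h4 : (η * ‖gradient f y - gradient f x‖) ^ 2 ≤ (η * (L * ‖y - x‖)) ^ 2 := by gcongr
  have h5 := mul_le_mul_of_nonneg_left h1 hη
  have h6 : η * (η * L ^ 2) * ‖y - x‖ ^ 2 ≤ η * (2 * μ) * ‖y - x‖ ^ 2 := by gcongr
  nlinarith

/-- The gradient is taken at `z` instead of `x`, as at an agent whose ratio differs from the
average. The coefficient of `‖x‖` stays exactly `1`, which rules out uncontrolled polynomial growth.
-/
lemma norm_gradient_step_le {f : E → ℝ} {μ η : ℝ} {L : NNReal} (hf : Differentiable ℝ f)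
    (hlip : LipschitzWith L (gradient f)) (hconv : StrongConvexOn Set.univ μ f) (hη : 0 ≤ η)
    (hη' : η * L ^ 2 ≤ 2 * μ) (x z : E) :
    ‖x - η • gradient f z‖ ≤ ‖x‖ + η * (‖gradient f 0‖ + L * ‖z - x‖) := by
  have h1 := norm_gradient_step_sub_le hf hlip hconv hη hη' 0 x
  have h2 : ‖gradient f z - gradient f x‖ ≤ L * ‖z - x‖ := by
    simpa [dist_eq_norm] using hlip.dist_le_mul z x
  have h3 : x - η • gradient f z = ((x - η • gradient f x) - (0 - η • gradient f 0))
      + (-(η • gradient f 0) + -(η • (gradient f z - gradient f x))) := by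
    rw [smul_sub]; abel
  rw [h3]
  refine (norm_add_le _ _).trans (add_le_add (by simpa using h1) ?_)
  refine (norm_add_le _ _).trans ?_
  rw [norm_neg, norm_neg, norm_smul, norm_smul, Real.norm_of_nonneg hη, mul_add]
  gcongr

end Analysis

/-! ### The coupled scalar recursion -/

/-- Inductive step for `exists_bound_of_coupled_recursion`, with `s = √(t + 1)`, `r = √(t + 2)`. -/
lemma coupled_recursion_step {s r K β c₁ c₂ lam x h x' h' : ℝ} (hs : 0 < s) (hr : 0 < r)
    (hsr : r ^ 2 = s ^ 2 + 1) (hK : 0 < K) (hβ : 0 < β) (hlam : 0 ≤ lam) (hlam1 : lam ≤ 1)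
    (hc₁ : 0 ≤ c₁) (hβeq : (1 - lam) * β = c₁ + 1) (hKc : 4 * c₂ ≤ K)
    (hb1 : 4 * (c₁ * β) ≤ s * r) (hb2 : β ≤ s ^ 2) (hx : x ≤ K * s) (hh : h ≤ K * β / s)
    (hx' : x' ≤ x + c₁ * h / r ^ 2 + c₂ / r)
    (hh' : h' ≤ lam * h + c₁ * (h + x) / r ^ 2 + c₂ / r) :
    x' ≤ K * r ∧ h' ≤ K * β / r := by
  have hle : s ≤ r := by nlinarith
  have e1 : c₁ * h / r ^ 2 ≤ K * (1 / 4) / r := by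
    calc c₁ * h / r ^ 2 ≤ c₁ * (K * β / s) / r ^ 2 := by gcongr
      _ = K * (c₁ * β / (s * r)) / r := by field_simp
      _ ≤ K * (1 / 4) / r := by
        have : c₁ * β / (s * r) ≤ 1 / 4 := by
          rw [div_le_iff₀ (by positivity)]
          linarith
        gcongr
  have e2 : c₂ / r ≤ K * (1 / 4) / r := by
    gcongr
    linarith
  -- `r - s = 1 / (r + s) ≥ 1 / (2 r)`: the growth of the square root absorbs the increments.
  have e3 : K * s + K * (1 / 2) / r ≤ K * r := by
    have : s + 1 / 2 / r ≤ r := by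
      rw [← le_sub_iff_add_le', div_le_iff₀ hr]
      nlinarith
    calc _ = K * (s + 1 / 2 / r) := by ring
      _ ≤ _ := by gcongr
  have e4 : c₁ * x / r ^ 2 ≤ K * c₁ / r := by
    have hxr : x ≤ K * r := hx.trans (by gcongr)
    calc c₁ * x / r ^ 2 ≤ c₁ * (K * r) / r ^ 2 := by gcongr
      _ = _ := by field_simp
  -- Passing from `1 / s` to `1 / r` costs a factor `1 + 1 / (2 s²)`, which adds at most `1 / 2` to
  -- `lam * β` since `β ≤ s²`.
  have e5 : lam * h ≤ K * (lam * β + 1 / 2) / r := by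
    have hrs : r / s ≤ 1 + 1 / (2 * s ^ 2) := by
      rw [div_le_iff₀ hs]
      have h1 : (1 + 1 / (2 * s ^ 2)) * s = s + 1 / (2 * s) := by field_simp
      rw [h1, ← sub_le_iff_le_add', le_div_iff₀ (by positivity)]
      nlinarith
    have h2 : β / s ^ 2 ≤ 1 := (div_le_one (by positivity)).2 hb2
    have h3 : lam * (β / s ^ 2) ≤ 1 := by nlinarith
    have hq : lam * β * (r / s) ≤ lam * β + 1 / 2 := by
      calc lam * β * (r / s) ≤ lam * β * (1 + 1 / (2 * s ^ 2)) := by gcongr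
        _ = lam * β + lam * (β / s ^ 2) / 2 := by field_simp
        _ ≤ lam * β + 1 / 2 := by linarith
    calc lam * h ≤ lam * (K * β / s) := by gcongr
      _ = K * (lam * β * (r / s)) / r := by field_simp
      _ ≤ _ := by gcongr
  constructor
  · have : K * (1 / 4) / r + K * (1 / 4) / r = K * (1 / 2) / r := by ring
    linarith
  · have e6 : c₁ * (h + x) / r ^ 2 = c₁ * h / r ^ 2 + c₁ * x / r ^ 2 := by ring
    have e7 : K * β / r = K * (lam * β + 1 / 2) / r + K * (1 / 4) / r + K * c₁ / r
        + K * (1 / 4) / r := by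
      have h1 : β = lam * β + 1 / 2 + 1 / 4 + c₁ + 1 / 4 := by linarith
      calc K * β / r = K * (lam * β + 1 / 2 + 1 / 4 + c₁ + 1 / 4) / r := by rw [← h1]
        _ = _ := by ring
    linarith

/-- Coupled recursion in which `x` grows at most like `√t` and `h` decays like `1 / √t`. -/
theorem exists_bound_of_coupled_recursion {x h : ℕ → ℝ} {lam c₁ c₂ : ℝ} (hlam : 0 ≤ lam)
    (hlam1 : lam < 1) (hc₁ : 0 ≤ c₁) (T : ℕ)
    (hxrec : ∀ t, T ≤ t → x (t + 1) ≤ x t + c₁ * h t / (t + 2) + c₂ / √(t + 2))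
    (hhrec : ∀ t, T ≤ t →
      h (t + 1) ≤ lam * h t + c₁ * (h t + x t) / (t + 2) + c₂ / √(t + 2)) :
    ∃ K, 0 < K ∧ ∀ t : ℕ, h t ≤ K / √(t + 1) := by
  -- In `(1 - lam) * β = c₁ + 1`, the term `c₁` pays for the feedback from `x`; the remaining `1`
  -- splits as `1/2 + 1/4 + 1/4` among the change of square root, the feedback from `h`, and the
  -- noise.
  set β : ℝ := (c₁ + 1) / (1 - lam) with hβ
  have h1lam : 0 < 1 - lam := by linarith
  have hβpos : 0 < β := by positivity
  have hβeq : (1 - lam) * β = c₁ + 1 := by rw [hβ]; field_simp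
  -- From `T₁` on, the largeness conditions `4 * (c₁ * β) ≤ s * r` and `β ≤ s ^ 2` hold.
  obtain ⟨T₁, hT₁⟩ := exists_nat_ge (4 * c₁ * β + β)
  set S := max T T₁ with hS
  -- The summands serve positivity, the noise term, and the base case at `S` for `x` and for `h`.
  set K : ℝ := 1 + |4 * c₂| + |x S| + |h S * √(S + 1) / β| with hK
  have hKpos : 0 < K := by rw [hK]; positivity
  have hKc : 4 * c₂ ≤ K := by
    rw [hK]
    linarith [le_abs_self (4 * c₂), abs_nonneg (x S), abs_nonneg (h S * √(S + 1) / β)]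
  have hind : ∀ t, S ≤ t → x t ≤ K * √(t + 1) ∧ h t ≤ K * β / √(t + 1) := by
    intro t ht
    induction t, ht using Nat.le_induction with
    | base =>
      have hs : 1 ≤ √((S : ℝ) + 1) := Real.one_le_sqrt.2 (by linarith [Nat.cast_nonneg (α := ℝ) S])
      constructor
      · have hxK : x S ≤ K := by
          rw [hK]
          linarith [le_abs_self (x S), abs_nonneg (4 * c₂), abs_nonneg (h S * √(S + 1) / β)]
        nlinarith
      · have hhK : h S * √(S + 1) / β ≤ K := by
          rw [hK]
          linarith [le_abs_self (h S * √(S + 1) / β), abs_nonneg (4 * c₂), abs_nonneg (x S)]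
        rw [le_div_iff₀ (by positivity)]
        rwa [div_le_iff₀ hβpos] at hhK
    | succ t ht ih =>
      obtain ⟨ihx, ihh⟩ := ih
      have hTt : T ≤ t := (le_max_left _ _).trans ht
      have hT₁t : (T₁ : ℝ) ≤ t := by exact_mod_cast (le_max_right T T₁).trans ht
      have ht0 : (0 : ℝ) ≤ t := Nat.cast_nonneg t
      push_cast
      rw [show (t : ℝ) + 1 + 1 = t + 2 by ring]
      have hxr := hxrec t hTt
      have hhr := hhrec t hTt
      set s := √((t : ℝ) + 1) with hs
      set r := √((t : ℝ) + 2) with hr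
      have hs2 : s ^ 2 = t + 1 := Real.sq_sqrt (by linarith)
      have hr2 : r ^ 2 = t + 2 := Real.sq_sqrt (by linarith)
      have hspos : 0 < s := Real.sqrt_pos.2 (by linarith)
      have hrpos : 0 < r := Real.sqrt_pos.2 (by linarith)
      have hsr : s ≤ r := Real.sqrt_le_sqrt (by linarith)
      have hprod := mul_nonneg hc₁ hβpos.le
      have hb1 : 4 * (c₁ * β) ≤ s * r := by nlinarith
      have hb2 : β ≤ s ^ 2 := by linarith
      rw [← hr2] at hxr hhr
      exact coupled_recursion_step hspos hrpos (by linarith) hKpos hβpos hlam hlam1.le hc₁ hβeq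
        hKc hb1 hb2 ihx ihh hxr hhr
  refine ⟨K * β + ∑ t ∈ Finset.range S, |h t| * √(t + 1), ?_, fun t => ?_⟩
  · have : 0 ≤ ∑ t ∈ Finset.range S, |h t| * √((t : ℝ) + 1) := by positivity
    have : 0 < K * β := by positivity
    linarith
  · have hsp : 0 < √((t : ℝ) + 1) := Real.sqrt_pos.2 (by positivity)
    rw [le_div_iff₀ hsp]
    rcases lt_or_ge t S with hlt | hge
    · have h1 : |h t| * √((t : ℝ) + 1) ≤ ∑ t ∈ Finset.range S, |h t| * √((t : ℝ) + 1) :=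
        Finset.single_le_sum (f := fun t : ℕ => |h t| * √((t : ℝ) + 1))
          (fun _ _ => by positivity) (Finset.mem_range.2 hlt)
      have h2 : h t * √((t : ℝ) + 1) ≤ |h t| * √((t : ℝ) + 1) := by gcongr; exact le_abs_self _
      have : 0 < K * β := by positivity
      linarith
    · have h1 := (hind t hge).2
      rw [le_div_iff₀ hsp] at h1
      have : 0 ≤ ∑ t ∈ Finset.range S, |h t| * √((t : ℝ) + 1) := by positivity
      linarith

/-! ### Pathwise estimates, integrability and moment recursions -/

section Langevin

variable {m d : ℕ}

/-- The perturbation of the linear push-sum dynamics by gradient step and noise. -/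
noncomputable def perturbation (G : ℕ → Digraph (Fin m)) (U : Fin m → EuclideanSpace ℝ (Fin d) → ℝ)
    (α : ℕ → ℝ) (b : ℕ → Fin m → EuclideanSpace ℝ (Fin d)) :
    ℕ → Fin m → EuclideanSpace ℝ (Fin d)
  | 0 => fun _ => 0
  | t + 1 => fun i => √(2 * α (t + 1)) • b (t + 1) i
      - α (t + 1) • gradient (U i) (ratio G U α b (t + 1) i)

variable {G : ℕ → Digraph (Fin m)} {U : Fin m → EuclideanSpace ℝ (Fin d) → ℝ} {L : NNReal}
  {α : ℕ → ℝ} {b : ℕ → Fin m → EuclideanSpace ℝ (Fin d)}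

lemma iterate_succ (t : ℕ) (i : Fin m) : iterate G U α b (t + 1) i
    = mix (G t) (iterate G U α b t) i + perturbation G U α b (t + 1) i := by
  simp only [iterate, perturbation, ratio]
  abel

lemma average_succ (t : ℕ) : average G U α b (t + 1)
    = average G U α b t + (m : ℝ)⁻¹ • ∑ i, perturbation G U α b (t + 1) i := by
  simp only [average, iterate_succ, Finset.sum_add_distrib, sum_mix, smul_add]

lemma norm_gradient_le {E : Type*} [NormedAddCommGroup E] [InnerProductSpace ℝ E] [CompleteSpace E]
    {f : E → ℝ} (hf : LipschitzWith L (gradient f)) (z : E) :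
    ‖gradient f z‖ ≤ ‖gradient f 0‖ + L * ‖z‖ := by
  have h := hf.dist_le_mul z 0
  rw [dist_eq_norm, dist_zero_right] at h
  have := norm_sub_norm_le (gradient f z) (gradient f 0)
  linarith

/-- Here the average may enter with a Lipschitz coefficient, since it is multiplied by `α = O(1 /
t)`. -/
lemma sum_norm_perturbation_le (hU : ∀ i, LipschitzWith L (gradient (U i))) {t : ℕ}
    (hα : 0 ≤ α (t + 1)) {H : ℝ}
    (hH : ∀ i, ‖ratio G U α b (t + 1) i - average G U α b t‖ ≤ H) :
    ∑ i, ‖perturbation G U α b (t + 1) i‖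
      ≤ α (t + 1) * (∑ i, ‖gradient (U i) 0‖ + m * L * (H + ‖average G U α b t‖))
        + √(2 * α (t + 1)) * ∑ i, ‖b (t + 1) i‖ := by
  have h1 : ∀ i, ‖perturbation G U α b (t + 1) i‖
      ≤ α (t + 1) * (‖gradient (U i) 0‖ + L * (H + ‖average G U α b t‖))
        + √(2 * α (t + 1)) * ‖b (t + 1) i‖ := by
    intro i
    rw [perturbation]
    refine (norm_sub_le _ _).trans ?_
    rw [norm_smul, norm_smul, Real.norm_of_nonneg hα, Real.norm_of_nonneg (Real.sqrt_nonneg _),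
      add_comm]
    have h2 : ‖ratio G U α b (t + 1) i‖ ≤ H + ‖average G U α b t‖ := by
      have := norm_sub_norm_le (ratio G U α b (t + 1) i) (average G U α b t)
      linarith [hH i]
    have h3 := norm_gradient_le (hU i) (ratio G U α b (t + 1) i)
    gcongr
    exact h3.trans (by gcongr)
  refine (Finset.sum_le_sum fun i _ => h1 i).trans (le_of_eq ?_)
  simp only [Finset.sum_add_distrib, ← Finset.mul_sum, Finset.sum_const, Finset.card_univ,
    Fintype.card_fin, nsmul_eq_mul]
  ring

lemma norm_average_succ_le {μ : ℝ} (hm : 0 < m) (hdiff : ∀ i, Differentiable ℝ (U i))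
    (hU : ∀ i, LipschitzWith L (gradient (U i))) (hconv : ∀ i, StrongConvexOn Set.univ μ (U i))
    {t : ℕ} (hα : 0 ≤ α (t + 1)) (hα' : α (t + 1) * L ^ 2 ≤ 2 * μ) {H : ℝ}
    (hH : ∀ i, ‖ratio G U α b (t + 1) i - average G U α b t‖ ≤ H) :
    ‖average G U α b (t + 1)‖ ≤ ‖average G U α b t‖
      + α (t + 1) * (∑ i, ‖gradient (U i) 0‖ + L * H)
      + √(2 * α (t + 1)) * ∑ i, ‖b (t + 1) i‖ := by
  have hm' : (1 : ℝ) ≤ m := by exact_mod_cast hm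
  have hm0 : (m : ℝ) ≠ 0 := by positivity
  set y := average G U α b t with hy
  have h1 : average G U α b (t + 1) = (m : ℝ)⁻¹ • ∑ i,
      ((y - α (t + 1) • gradient (U i) (ratio G U α b (t + 1) i))
        + √(2 * α (t + 1)) • b (t + 1) i) := by
    -- Writing `y` as a mean of `m` copies turns the update into a mean of single-agent gradient
    -- steps started at `y`, each nonexpansive up to the consensus error.
    have h2 : y = (m : ℝ)⁻¹ • ∑ _i : Fin m, y := by
      rw [Finset.sum_const, Finset.card_univ, Fintype.card_fin, ← Nat.cast_smul_eq_nsmul ℝ,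
        smul_smul, inv_mul_cancel₀ hm0, one_smul]
    rw [average_succ, ← hy]
    nth_rewrite 1 [h2]
    rw [← smul_add, ← Finset.sum_add_distrib]
    congr 1
    refine Finset.sum_congr rfl fun i _ => ?_
    rw [perturbation, add_sub, sub_add_eq_add_sub]
  have h3 : ∀ i, ‖(y - α (t + 1) • gradient (U i) (ratio G U α b (t + 1) i))
        + √(2 * α (t + 1)) • b (t + 1) i‖ ≤ ‖y‖ + α (t + 1) * (∑ i, ‖gradient (U i) 0‖ + L * H)
          + √(2 * α (t + 1)) * ∑ i, ‖b (t + 1) i‖ := by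
    intro i
    refine (norm_add_le _ _).trans (add_le_add ?_ ?_)
    · refine (norm_gradient_step_le (hdiff i) (hU i) (hconv i) hα hα' y _).trans ?_
      have h4 : ‖gradient (U i) 0‖ ≤ ∑ i, ‖gradient (U i) 0‖ :=
        Finset.single_le_sum (f := fun i => ‖gradient (U i) 0‖) (fun _ _ => norm_nonneg _)
          (Finset.mem_univ i)
      have h5 := hH i
      gcongr
    · rw [norm_smul, Real.norm_of_nonneg (Real.sqrt_nonneg _)]
      gcongr
      exact Finset.single_le_sum (f := fun i => ‖b (t + 1) i‖) (fun _ _ => norm_nonneg _)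
          (Finset.mem_univ i)
  rw [h1, norm_smul, norm_inv, Real.norm_natCast, inv_mul_le_iff₀ (by positivity)]
  refine (norm_sum_le_of_le _ fun i _ => h3 i).trans (le_of_eq ?_)
  rw [Finset.sum_const, Finset.card_univ, Fintype.card_fin, nsmul_eq_mul]

variable {Ω : Type*} {mΩ : MeasurableSpace Ω} {P : Measure Ω}
  {β : Ω → ℕ → Fin m → EuclideanSpace ℝ (Fin d)}

lemma integrable_mix {x : Ω → Fin m → EuclideanSpace ℝ (Fin d)}
    (hx : ∀ i, Integrable (fun ω => x ω i) P) (G : Digraph (Fin m)) (i : Fin m) :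
    Integrable (fun ω => mix G (x ω) i) P :=
  integrable_finsetSum _ fun j _ => (hx j).smul (outDegree G j : ℝ)⁻¹

lemma integrable_discountedSum {e : Ω → ℕ → ℝ} (he : ∀ t, Integrable (fun ω => e ω (t + 1)) P)
    (C lam : ℝ) (t : ℕ) : Integrable (fun ω => discountedSum C lam (e ω) t) P := by
  induction t with
  | zero => simp [discountedSum]
  | succ t ih => exact (ih.const_mul _).add ((he t).const_mul _)

variable [IsProbabilityMeasure P]

lemma integrable_gradient_comp {f : EuclideanSpace ℝ (Fin d) → ℝ}
    (hf : LipschitzWith L (gradient f)) {z : Ω → EuclideanSpace ℝ (Fin d)} (hz : Integrable z P) :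
    Integrable (fun ω => gradient f (z ω)) P :=
  Integrable.mono' ((integrable_const ‖gradient f 0‖).add (hz.norm.const_mul (L : ℝ)))
    (hf.continuous.comp_aestronglyMeasurable hz.1)
    (Filter.Eventually.of_forall fun ω => norm_gradient_le hf (z ω))

lemma integrable_iterate (hU : ∀ i, LipschitzWith L (gradient (U i)))
    (hβ : ∀ t i, Integrable (fun ω => β ω (t + 1) i) P) (t : ℕ) (i : Fin m) :
    Integrable (fun ω => iterate G U α (β ω) t i) P := by
  induction t generalizing i with
  | zero => simp [iterate]
  | succ t ih =>
    have h1 := fun i => integrable_mix ih (G t) i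
    have h2 : Integrable (fun ω => gradient (U i) (ratioStep G t (iterate G U α (β ω) t) i)) P :=
      integrable_gradient_comp (hU i) ((h1 i).smul (weight G (t + 1) i)⁻¹)
    exact ((h1 i).sub (h2.smul (α (t + 1)))).add ((hβ t i).smul √(2 * α (t + 1)))

lemma integrable_ratio (hU : ∀ i, LipschitzWith L (gradient (U i)))
    (hβ : ∀ t i, Integrable (fun ω => β ω (t + 1) i) P) (t : ℕ) (i : Fin m) :
    Integrable (fun ω => ratio G U α (β ω) (t + 1) i) P :=
  (integrable_mix (integrable_iterate hU hβ t) (G t) i).smul (weight G (t + 1) i)⁻¹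

lemma integrable_average (hU : ∀ i, LipschitzWith L (gradient (U i)))
    (hβ : ∀ t i, Integrable (fun ω => β ω (t + 1) i) P) (t : ℕ) :
    Integrable (fun ω => average G U α (β ω) t) P :=
  (integrable_finsetSum Finset.univ fun i _ => integrable_iterate hU hβ t i).smul (m : ℝ)⁻¹

lemma integrable_perturbation (hU : ∀ i, LipschitzWith L (gradient (U i)))
    (hβ : ∀ t i, Integrable (fun ω => β ω (t + 1) i) P) (t : ℕ) (i : Fin m) :
    Integrable (fun ω => perturbation G U α (β ω) (t + 1) i) P :=
  ((hβ t i).smul √(2 * α (t + 1))).sub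
    ((integrable_gradient_comp (hU i) (integrable_ratio hU hβ t i)).smul (α (t + 1)))

lemma integrable_affine {f h k : Ω → ℝ} (hf : Integrable f P) (hh : Integrable h P)
    (hk : Integrable k P) (g p q r : ℝ) :
    Integrable (fun ω => f ω + p * (g + q * h ω) + r * k ω) P :=
  (hf.add (((integrable_const g).add (hh.const_mul q)).const_mul p)).add (hk.const_mul r)

lemma integral_affine {f h k : Ω → ℝ} (hf : Integrable f P) (hh : Integrable h P)
    (hk : Integrable k P) (g p q r : ℝ) :
    ∫ ω, (f ω + p * (g + q * h ω) + r * k ω) ∂P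
      = ∫ ω, f ω ∂P + p * (g + q * ∫ ω, h ω ∂P) + r * ∫ ω, k ω ∂P := by
  have h1 : Integrable (fun ω => g + q * h ω) P := (integrable_const g).add (hh.const_mul q)
  have h2 : Integrable (fun ω => f ω + p * (g + q * h ω)) P := hf.add (h1.const_mul p)
  rw [integral_add h2 (hk.const_mul r), integral_add hf (h1.const_mul p), integral_const_mul,
    integral_const_mul, integral_add (integrable_const g) (hh.const_mul q), integral_const_mul]
  simp

/-- Consensus at rate `1 / √t` for push-sum dynamics driven by noise with bounded first moments. -/
theorem exists_consensus_bound {B : ℕ} (hm : 0 < m) (hG : IsBStronglyConnected G B) {μ : ℝ}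
    (hμ : 0 < μ) (hdiff : ∀ i, Differentiable ℝ (U i))
    (hU : ∀ i, LipschitzWith L (gradient (U i))) (hconv : ∀ i, StrongConvexOn Set.univ μ (U i))
    {a : ℝ} (hα : ∀ t, 0 ≤ α t) (hα' : ∀ t, α t ≤ a / (1 + (t : ℝ)))
    (hβ : ∀ t i, Integrable (fun ω => β ω (t + 1) i) P) {M : ℝ}
    (hM : ∀ t i, ∫ ω, ‖β ω (t + 1) i‖ ∂P ≤ M) :
    ∃ K : ℝ, 0 < K ∧ ∀ t i,
      ∫ ω, ‖average G U α (β ω) t - ratio G U α (β ω) (t + 1) i‖ ∂P ≤ K / √(t + 1) := by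
  obtain ⟨C, lam, hC, hlam, hlam1, hmix⟩ := exists_geometric_mixing hG hm
  set e : Ω → ℕ → ℝ := fun ω t => ∑ j, ‖perturbation G U α (β ω) t j‖ with he
  set H : ℕ → Ω → ℝ := fun t ω => discountedSum C lam (e ω) t with hH
  have hcons : ∀ t ω i, ‖ratio G U α (β ω) (t + 1) i - average G U α (β ω) t‖ ≤ H t ω :=
    fun t ω i => norm_ratioStep_sub_average_le hC.le hlam.le hlam1.le hmix rfl
      (fun t i => iterate_succ t i) t i
  have hei : ∀ t, Integrable (fun ω => e ω (t + 1)) P := fun t =>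
    integrable_finsetSum _ fun i _ => (integrable_perturbation hU hβ t i).norm
  have hHi : ∀ t, Integrable (H t) P := fun t => integrable_discountedSum hei C lam t
  have hH0 : ∀ t, 0 ≤ ∫ ω, H t ω ∂P := fun t => integral_nonneg fun ω =>
    discountedSum_nonneg hC.le hlam.le (fun t => Finset.sum_nonneg fun j _ => norm_nonneg _) t
  have hAi : ∀ t, Integrable (fun ω => ‖average G U α (β ω) t‖) P := fun t =>
    (integrable_average hU hβ t).norm
  have hA0 : ∀ t, 0 ≤ ∫ ω, ‖average G U α (β ω) t‖ ∂P := fun t =>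
    integral_nonneg fun ω => norm_nonneg _
  have hbi : ∀ t, Integrable (fun ω => ∑ i, ‖β ω (t + 1) i‖) P := fun t =>
    integrable_finsetSum _ fun i _ => (hβ t i).norm
  have hbM : ∀ t, ∫ ω, ∑ i, ‖β ω (t + 1) i‖ ∂P ≤ m * M := by
    intro t
    rw [integral_finsetSum _ fun i _ => (hβ t i).norm]
    refine (Finset.sum_le_sum fun i _ => hM t i).trans (le_of_eq (by simp))
  have hM0 : 0 ≤ M := (integral_nonneg fun ω => norm_nonneg _).trans (hM 0 ⟨0, hm⟩)
  have ha : 0 ≤ a := by simpa using (hα 0).trans (hα' 0)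
  set g : ℝ := ∑ i, ‖gradient (U i) 0‖ with hg
  have hg0 : 0 ≤ g := Finset.sum_nonneg fun i _ => norm_nonneg _
  -- the moment recursions
  have hrec1 : ∀ t, α (t + 1) * L ^ 2 ≤ 2 * μ → ∫ ω, ‖average G U α (β ω) (t + 1)‖ ∂P
      ≤ ∫ ω, ‖average G U α (β ω) t‖ ∂P + α (t + 1) * (g + L * ∫ ω, H t ω ∂P)
        + √(2 * α (t + 1)) * (m * M) := by
    intro t ht
    refine (integral_mono (hAi (t + 1)) (integrable_affine (hAi t) (hHi t) (hbi t) _ _ _ _)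
      fun ω => norm_average_succ_le hm hdiff hU hconv (hα (t + 1)) ht (hcons t ω)).trans ?_
    rw [integral_affine (hAi t) (hHi t) (hbi t)]
    gcongr
    exact hbM t
  have hrec2 : ∀ t, ∫ ω, H (t + 1) ω ∂P ≤ lam * ∫ ω, H t ω ∂P
      + C * (α (t + 1) * (g + m * L * (∫ ω, H t ω ∂P + ∫ ω, ‖average G U α (β ω) t‖ ∂P))
        + √(2 * α (t + 1)) * (m * M)) := by
    intro t
    have h0 : ∫ ω, H (t + 1) ω ∂P = lam * ∫ ω, H t ω ∂P + C * ∫ ω, e ω (t + 1) ∂P := by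
      rw [← integral_const_mul, ← integral_const_mul, ← integral_add ((hHi t).const_mul _)
        ((hei t).const_mul _)]
      rfl
    rw [h0]
    gcongr
    have hsum : Integrable (fun ω => H t ω + ‖average G U α (β ω) t‖) P := (hHi t).add (hAi t)
    refine (integral_mono (hei t)
      (integrable_affine (integrable_zero Ω ℝ P) hsum (hbi t) g (α (t + 1)) (m * L)
        √(2 * α (t + 1))) fun ω => ?_).trans ?_
    · rw [Pi.zero_apply, zero_add]
      exact sum_norm_perturbation_le hU (hα (t + 1)) (hcons t ω)
    rw [integral_affine (integrable_zero Ω ℝ P) hsum (hbi t), integral_add (hHi t) (hAi t)]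
    simp only [Pi.zero_apply, integral_zero, zero_add]
    gcongr
    exact hbM t
  have hα2 : ∀ t : ℕ, α (t + 1) ≤ a / (t + 2) := fun t => by
    have := hα' (t + 1)
    push_cast at this
    rwa [show (1 : ℝ) + (t + 1) = t + 2 by ring] at this
  have hnoise : ∀ t : ℕ, α (t + 1) * g + √(2 * α (t + 1)) * (m * M)
      ≤ (a * g + √(2 * a) * (m * M)) / √(t + 2) := by
    intro t
    have ht : (0 : ℝ) ≤ t := Nat.cast_nonneg t
    have h1 : √(2 * α (t + 1)) ≤ √(2 * a) / √(t + 2) := by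
      rw [← Real.sqrt_div (by positivity)]
      apply Real.sqrt_le_sqrt
      rw [mul_div_assoc]
      linarith [hα2 t]
    -- The drift constant is weakened from order `1 / t` to `1 / √t` and merged with the noise.
    have h2 : α (t + 1) ≤ a / √(t + 2) := by
      refine (hα2 t).trans ?_
      have h3 : √((t : ℝ) + 2) ≤ t + 2 := by
        rw [Real.sqrt_le_left (by linarith)]
        nlinarith
      have h4 : 0 < √((t : ℝ) + 2) := Real.sqrt_pos.2 (by linarith)
      gcongr
    calc _ ≤ a / √(t + 2) * g + √(2 * a) / √(t + 2) * (m * M) := by gcongr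
      _ = _ := by ring
  set c : ℝ := a * g + √(2 * a) * (m * M) with hc
  have hc0 : 0 ≤ c := by positivity
  -- From `T` on the step size satisfies `α * L ^ 2 ≤ 2 * μ`.
  obtain ⟨T, hT⟩ := exists_nat_ge (a * L ^ 2 / (2 * μ))
  obtain ⟨K, hK, hKt⟩ := exists_bound_of_coupled_recursion
    (x := fun t => ∫ ω, ‖average G U α (β ω) t‖ ∂P) (h := fun t => ∫ ω, H t ω ∂P)
    -- Each constant is a sum of the coefficients from the two recursions, so that both share the
    -- same `c₁` and `c₂`.
    (c₁ := a * L + C * m * L * a) (c₂ := (1 + C) * c) hlam.le hlam1 (by positivity) T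
    (fun t ht => by
      have hTt : (T : ℝ) ≤ t := by exact_mod_cast ht
      have hsmall : α (t + 1) * L ^ 2 ≤ 2 * μ := by
        have h1 : α (t + 1) * L ^ 2 ≤ a / (t + 2) * L ^ 2 := by
          have := hα2 t
          gcongr
        refine h1.trans ?_
        rw [div_mul_eq_mul_div, div_le_iff₀ (by positivity)]
        rw [div_le_iff₀ (by positivity)] at hT
        nlinarith
      have h2 := hrec1 t hsmall
      have h3 : α (t + 1) * (L * ∫ ω, H t ω ∂P)
          ≤ (a * L + C * m * L * a) * (∫ ω, H t ω ∂P) / (t + 2) := by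
        have := hH0 t
        calc _ ≤ a / (t + 2) * (L * ∫ ω, H t ω ∂P) := by
              have := hα2 t
              gcongr
          _ = (a * L) * (∫ ω, H t ω ∂P) / (t + 2) := by ring
          _ ≤ _ := by
              gcongr
              exact le_add_of_nonneg_right (by positivity)
      have h4 : c / √((t : ℝ) + 2) ≤ (1 + C) * c / √((t : ℝ) + 2) := by
        gcongr
        nlinarith
      have h5 := hnoise t
      linarith)
    (fun t ht => by
      have h2 := hrec2 t
      have h3 : C * (α (t + 1) * (m * L * (∫ ω, H t ω ∂P + ∫ ω, ‖average G U α (β ω) t‖ ∂P)))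
          ≤ (a * L + C * m * L * a) * (∫ ω, H t ω ∂P + ∫ ω, ‖average G U α (β ω) t‖ ∂P)
            / (t + 2) := by
        have h6 := hH0 t
        have h7 := hA0 t
        calc _ ≤ C * (a / (t + 2) *
                (m * L * (∫ ω, H t ω ∂P + ∫ ω, ‖average G U α (β ω) t‖ ∂P))) := by
              have := hα2 t
              gcongr
          _ = (C * m * L * a) * (∫ ω, H t ω ∂P + ∫ ω, ‖average G U α (β ω) t‖ ∂P)
                / (t + 2) := by ring
          _ ≤ _ := by
              gcongr
              exact le_add_of_nonneg_left (by positivity)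
      have h5 : C * (α (t + 1) * g + √(2 * α (t + 1)) * (m * M))
          ≤ (1 + C) * c / √((t : ℝ) + 2) := by
        calc _ ≤ C * (c / √((t : ℝ) + 2)) := by
              have := hnoise t
              gcongr
          _ = C * c / √((t : ℝ) + 2) := by ring
          _ ≤ _ := by
              gcongr
              linarith
      linarith)
  refine ⟨K, hK, fun t i => le_trans ?_ (hKt t)⟩
  exact integral_mono ((integrable_average hU hβ t).sub (integrable_ratio hU hβ t i)).norm (hHi t)
    fun ω => by
      simp only [norm_sub_rev (average G U α (β ω) t)]
      exact hcons t ω i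

end Langevin

/-! ### Moment bounds for the noise and the final rate -/

/-- First absolute moments are controlled by second moments. -/
lemma integral_norm_le_one_add_sq {Ω E : Type*} {mΩ : MeasurableSpace Ω} {P : Measure Ω}
    [IsProbabilityMeasure P] [NormedAddCommGroup E] {f : Ω → E} (hf : MemLp f 2 P) :
    ∫ ω, ‖f ω‖ ∂P ≤ 1 + ∫ ω, ‖f ω‖ ^ 2 ∂P := by
  have h2 : Integrable (fun ω => ‖f ω‖ ^ 2) P := hf.integrable_norm_pow two_ne_zero
  have h3 := integral_mono (μ := P) (hf.integrable one_le_two).norm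
    ((integrable_const (1 : ℝ)).add h2) (fun ω => by
      simp only [Pi.add_apply]
      nlinarith [sq_nonneg (‖f ω‖ - 1), norm_nonneg (f ω)])
  rw [integral_add' (integrable_const _) h2] at h3
  simpa using h3

end PushSumLangevin

theorem mainTheorem2 {Ω : Type*} {mΩ : MeasurableSpace Ω} (P : Measure Ω) [IsProbabilityMeasure P]
    (ℱ : Filtration ℕ mΩ) {m d : ℕ}
    -- the time-varying directed network
    (G : ℕ → Digraph (Fin m)) (B : ℕ) (hG : PushSumLangevin.IsBStronglyConnected G B)
    -- the potentials: strongly convex, continuously differentiable with Lipschitz gradient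
    (U : Fin m → EuclideanSpace ℝ (Fin d) → ℝ) (L : NNReal) (μ : ℝ) (hμ : 0 < μ)
    (hU_diff : ∀ i, Differentiable ℝ (U i))
    (hU_lip : ∀ i, LipschitzWith L (gradient (U i)))
    (hU_conv : ∀ i, StrongConvexOn Set.univ μ (U i))
    -- the step sizes
    (α : ℕ → ℝ) (a : ℝ) (hα_pos : ∀ t, 0 < α t) (hα_le : ∀ t, α t ≤ a / (1 + (t : ℝ)))
    -- the stochastic gradient errors: zero bias and bounded variance
    (ξ : ℕ → Fin m → Ω → EuclideanSpace ℝ (Fin d)) (σ : ℝ)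
    (hξ_meas : ∀ t i, StronglyMeasurable[ℱ (t + 1)] (ξ (t + 1) i))
    (hξ_L2 : ∀ t i, MemLp (ξ (t + 1) i) 2 P)
    (hξ_bias : ∀ t i, P[ξ (t + 1) i | ℱ t] =ᵐ[P] 0)
    (hξ_var : ∀ t i, ∫ ω, ‖ξ (t + 1) i ω‖ ^ 2 ∂P ≤ σ ^ 2)
    -- the injected noise: isotropic Gaussian (standard for `τ = 1`), independent of the past
    (R : ℕ → Fin m → Ω → EuclideanSpace ℝ (Fin d)) (τ : ℝ)
    (hR_meas : ∀ t i, StronglyMeasurable[ℱ (t + 1)] (R (t + 1) i))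
    (hR_law : ∀ t i, P.map (R (t + 1) i) =
      (stdGaussian (EuclideanSpace ℝ (Fin d))).map (fun x => τ • x))
    (hR_indep : ∀ t i, Indep (MeasurableSpace.comap (R (t + 1) i) inferInstance) (ℱ t) P)
    (γ : ℝ) (hγ : 0 < γ) :
    ∃ C : ℝ, 0 < C ∧ ∀ t : ℕ, 1 ≤ t → ∀ i : Fin m,
      Integrable (fun ω =>
        PushSumLangevin.average G U α (PushSumLangevin.noise α ξ R ω) t
          - PushSumLangevin.ratio G U α (PushSumLangevin.noise α ξ R ω) (t + 1) i) P ∧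
      ∫ ω, ‖PushSumLangevin.average G U α (PushSumLangevin.noise α ξ R ω) t
          - PushSumLangevin.ratio G U α (PushSumLangevin.noise α ξ R ω) (t + 1) i‖ ∂P
        ≤ C / (t : ℝ) ^ (1 / 2 - γ) := by
  have hR_aem : ∀ t i, AEMeasurable (R (t + 1) i) P := fun t i =>
    ((hR_meas t i).mono (ℱ.le (t + 1))).measurable.aemeasurable
  have hgauss : Integrable (fun x : EuclideanSpace ℝ (Fin d) => τ • x)
      (stdGaussian (EuclideanSpace ℝ (Fin d))) :=
    IsGaussian.integrable_id.smul τ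
  have hsm : Measurable (fun x : EuclideanSpace ℝ (Fin d) => τ • x) := by fun_prop
  have hRi : ∀ t i, Integrable (R (t + 1) i) P := fun t i => by
    have h : Integrable id (P.map (R (t + 1) i)) := by
      rw [hR_law t i, integrable_map_measure aestronglyMeasurable_id hsm.aemeasurable]
      exact hgauss
    exact (integrable_map_measure aestronglyMeasurable_id (hR_aem t i)).1 h
  -- The law does not depend on `t` or `i`, so one Gaussian moment bounds all these terms.
  have hRnorm : ∀ t i, ∫ ω, ‖R (t + 1) i ω‖ ∂P
      = ∫ x, ‖τ • x‖ ∂(stdGaussian (EuclideanSpace ℝ (Fin d))) := fun t i => by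
    have h := integral_map (hR_aem t i) (f := fun x => ‖x‖) continuous_norm.aestronglyMeasurable
    rw [← h, hR_law t i, integral_map hsm.aemeasurable continuous_norm.aestronglyMeasurable]
  have hξi : ∀ t i, Integrable (ξ (t + 1) i) P := fun t i => (hξ_L2 t i).integrable one_le_two
  have hβ : ∀ t i, Integrable (fun ω => PushSumLangevin.noise α ξ R ω (t + 1) i) P := fun t i =>
    ((hξi t i).smul √(α (t + 1))).add (hRi t i)
  have ha : 0 < a := by simpa using (hα_pos 0).trans_le (hα_le 0)
  have hαa : ∀ t, α t ≤ a := fun t => (hα_le t).trans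
    (div_le_self ha.le (by linarith [Nat.cast_nonneg (α := ℝ) t]))
  have hM : ∀ t i, ∫ ω, ‖PushSumLangevin.noise α ξ R ω (t + 1) i‖ ∂P
      ≤ √a * (1 + σ ^ 2) + ∫ x, ‖τ • x‖ ∂(stdGaussian (EuclideanSpace ℝ (Fin d))) := by
    intro t i
    have h1 : ∫ ω, ‖PushSumLangevin.noise α ξ R ω (t + 1) i‖ ∂P
        ≤ ∫ ω, (√(α (t + 1)) * ‖ξ (t + 1) i ω‖ + ‖R (t + 1) i ω‖) ∂P := by
      refine integral_mono (hβ t i).norm (((hξi t i).norm.const_mul _).add (hRi t i).norm)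
        fun ω => ?_
      refine (norm_add_le _ _).trans (le_of_eq ?_)
      rw [norm_smul, Real.norm_of_nonneg (Real.sqrt_nonneg _)]
    refine h1.trans ?_
    rw [integral_add ((hξi t i).norm.const_mul _) (hRi t i).norm, integral_const_mul, hRnorm]
    have h2 : ∫ ω, ‖ξ (t + 1) i ω‖ ∂P ≤ 1 + σ ^ 2 :=
      (PushSumLangevin.integral_norm_le_one_add_sq (hξ_L2 t i)).trans (by linarith [hξ_var t i])
    have h3 := hαa (t + 1)
    gcongr
  rcases Nat.eq_zero_or_pos m with rfl | hm
  · exact ⟨1, one_pos, fun t _ i => i.elim0⟩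
  obtain ⟨K, hK, hbound⟩ := PushSumLangevin.exists_consensus_bound hm hG hμ hU_diff hU_lip hU_conv
    (fun t => (hα_pos t).le) hα_le hβ hM
  refine ⟨K, hK, fun t ht i => ⟨(PushSumLangevin.integrable_average hU_lip hβ t).sub
    (PushSumLangevin.integrable_ratio hU_lip hβ t i), (hbound t i).trans ?_⟩⟩
  have ht' : (1 : ℝ) ≤ t := by exact_mod_cast ht
  -- Since `t ≥ 1`, lowering the exponent to `1 / 2 - γ` only decreases the power, whatever the sign
  -- of that exponent.
  have h1 : (t : ℝ) ^ (1 / 2 - γ) ≤ √((t : ℝ) + 1) := by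
    rw [Real.sqrt_eq_rpow]
    exact (Real.rpow_le_rpow_of_exponent_le ht' (by linarith)).trans
      (Real.rpow_le_rpow (by linarith) (by linarith) (by norm_num))
  have h2 : 0 < (t : ℝ) ^ (1 / 2 - γ) := Real.rpow_pos_of_pos (by linarith) _
  gcongr
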